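/- Let $F$ be an algebraically closed field, let $U,V,W$ be finite-dimensional vector spaces over $F$, and let $r\ge 0$ be an integer. For $T\in U\otimes V\otimes W$ and $x\in U^*$ let $Tx\in V\otimes W$ be the contraction of $T$ with $x$ in the first factor. The minrank of $T$ is the minimum of $\operatorname{rk}(Tx)$ over all nonzero $x\in U^*$ (and $\infty$ if $U=0$). Put \[ \mathcal M_{U\otimes V\otimes W,r}=\{T\in U\otimes V\otimes W \mid \exists\, x\in U^*\setminus\{0\}:\ \operatorname{rk}(Tx)\le r\}. \] (a) $\mathcal M_{U\otimes V\otimes W,r}$ is the set of tensors in $U\otimes V\otimes W$ of minrank at most $r$, and it is Zariski closed. Moreover, the set \[ \mathbb P\mathcal X_r=\{([T],[x])\in\mathbb P(U\otimes V\otimes W)\times\mathbb P(U^*) \mid \operatorname{rk}(Tx)\le r\} \] is Zariski closed, its image under the projection to the first factor is \[ \mathbb P\mathcal M_r=\{[T]\in\mathbb P(U\otimes V\otimes W)\mid \exists\, x\ne 0:\ \operatorname{rk}(Tx)\le r\}, \] the set $\mathbb P\mathcal M_r$ is Zariski closed in $\mathbb P(U\otimes V\otimes W)$, and, if $U\neq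 0$, $\mathcal M_{U\otimes V\otimes W,r}$ is the affine cone over $\mathbb P\mathcal M_r$ (with the origin included). (b) Let $\dim U=k\ge 1$, let $n\ge 0$, and let $L$ be a vector space over $F$ of dimension $(k-1)n+r$. Let $(e_i)_{1\le i\le k}$ be a basis of $U$ and let $(e_{ij})$, where $1\le i\le k$, $1\le j\le r$ if $i=1$ and $1\le j\le n$ if $i\ge 2$, be a basis of $L$. Let \[ T_{k,n,r}=e_1\otimes\Bigl(\sum_{j=1}^{r}e_{1j}\otimes e_{1j}\Bigr)+\sum_{i=2}^{k}e_i\otimes\Bigl(\sum_{j=1}^{n}e_{ij}\otimes e_{ij}\Bigr)\in U\otimes L\otimes L . \] Then for all subspaces $V',W'\subseteq L$ with $\dim V'=n$, \[ \mathcal M_{U\otimes V'\otimes W',r}=\overline{\bigl(\mathsf{GL}(U)\times\mathsf{GL}(L)\times\mathsf{GL}(L)\bigr)\,T_{k,n,r}}\ \cap\ (U\otimes V'\otimes W'), \] where the bar is the Zariski closure in $U\otimes L\otimes L$ and $U\otimes V'\otimes W'$ is regarded as a subspace of $U\otimes L\otimes L$. -/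

import Mathlib

open scoped TensorProduct LinearAlgebra.Projectivization

noncomputable section

namespace Minrank

section Zariski

variable (F : Type*) [Field F] {E E' : Type*} [AddCommGroup E] [Module F E]
  [AddCommGroup E'] [Module F E']

/-- The value at the vector `v` of a polynomial expression in linear functionals on `E`.
The functions `v ↦ polyEval F p v` are exactly the polynomial functions on `E`. -/
def polyEval (p : MvPolynomial (Module.Dual F E) F) (v : E) : F :=
  MvPolynomial.eval (fun φ : Module.Dual F E => φ v) p

/-- A subset of a vector space is Zariski closed if it is the set of common zeros of
a family of polynomial functions. -/
def IsZariskiClosed (Z : Set E) : Prop :=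
  ∃ S : Set (MvPolynomial (Module.Dual F E) F), Z = {v | ∀ p ∈ S, polyEval F p v = 0}

/-- The Zariski closure: the intersection of all Zariski closed sets containing `A`. -/
def zariskiClosure (A : Set E) : Set E :=
  ⋂₀ {Z | IsZariskiClosed F Z ∧ A ⊆ Z}

/-- A subset of the projective space `ℙ(E)` is Zariski closed if it is the set of common
zeros of a family of homogeneous polynomials (the vanishing of such a polynomial at a point
does not depend on the representative). -/
def IsProjClosed (Z : Set (ℙ F E)) : Prop :=
  ∃ S : Set (MvPolynomial (Module.Dual F E) F), (∀ p ∈ S, ∃ d : ℕ, p.IsHomogeneous d) ∧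
    Z = {z | ∀ p ∈ S, polyEval F p z.rep = 0}

/-- `p` is homogeneous of bidegree `d` in two groups of variables. -/
def IsBihomogeneous {σ τ : Type*} (p : MvPolynomial (σ ⊕ τ) F) (d : ℕ × ℕ) : Prop :=
  p.IsWeightedHomogeneous (Sum.elim (fun _ => ((1, 0) : ℕ × ℕ)) (fun _ => ((0, 1) : ℕ × ℕ))) d

/-- A subset of `ℙ(E) × ℙ(E')` is Zariski closed if it is the set of common zeros of a
family of bihomogeneous polynomials. -/
def IsBiprojClosed (Z : Set (ℙ F E × ℙ F E')) : Prop :=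
  ∃ S : Set (MvPolynomial (Module.Dual F E ⊕ Module.Dual F E') F),
    (∀ p ∈ S, ∃ d : ℕ × ℕ, IsBihomogeneous F p d) ∧
    Z = {z | ∀ p ∈ S, MvPolynomial.eval
      (Sum.elim (fun φ : Module.Dual F E => φ z.1.rep)
        (fun ψ : Module.Dual F E' => ψ z.2.rep)) p = 0}

/-- The affine cone over a subset of projective space, with the origin included. -/
def affineCone (Z : Set (ℙ F E)) : Set E :=
  {v | ∀ hv : v ≠ 0, Projectivization.mk F v hv ∈ Z}

end Zariski

section Tensors

variable (F : Type*) [Field F]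

/-- Contraction of the first tensor factor: `contract F x (u ⊗ₜ m) = x u • m`. -/
def contract {U M : Type*} [AddCommGroup U] [Module F U] [AddCommGroup M] [Module F M] :
    Module.Dual F U →ₗ[F] (U ⊗[F] M) →ₗ[F] M :=
  LinearMap.compr₂ (LinearMap.rTensorHom M) (TensorProduct.lid F M).toLinearMap

/-- The rank of `A ∈ V ⊗ W`, i.e. the rank of the linear map `V* → W`, `φ ↦ (φ ⊗ id) A`. -/
def rk {V W : Type*} [AddCommGroup V] [Module F V] [AddCommGroup W] [Module F W]
    (A : V ⊗[F] W) : ℕ :=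
  Module.finrank F (LinearMap.range ((contract F (U := V) (M := W)).flip A))

variable (U V W : Type*) [AddCommGroup U] [Module F U] [AddCommGroup V] [Module F V]
  [AddCommGroup W] [Module F W]

/-- The minrank of `T`: the minimum of `rk (T x)` over nonzero `x ∈ U*`
(`⊤` if there is no nonzero `x`). -/
def minrank {U V W : Type*} [AddCommGroup U] [Module F U] [AddCommGroup V] [Module F V]
    [AddCommGroup W] [Module F W] (T : U ⊗[F] (V ⊗[F] W)) : ℕ∞ :=
  ⨅ (x : Module.Dual F U) (_ : x ≠ 0), (rk F (contract F x T) : ℕ∞)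

/-- The affine minrank variety. -/
def minrankVariety (r : ℕ) : Set (U ⊗[F] (V ⊗[F] W)) :=
  {T | ∃ x : Module.Dual F U, x ≠ 0 ∧ rk F (contract F x T) ≤ r}

/-- The projective minrank variety (the condition on `[T]` does not depend on the
representative `T`). -/
def projMinrankVariety (r : ℕ) : Set (ℙ F (U ⊗[F] (V ⊗[F] W))) :=
  {t | ∃ x : Module.Dual F U, x ≠ 0 ∧ rk F (contract F x t.rep) ≤ r}

/-- The projective incidence variety of all `([T], [x])` with `rk (T x) ≤ r` (again
independent of the representatives). -/
def projIncidence (r : ℕ) : Set (ℙ F (U ⊗[F] (V ⊗[F] W)) × ℙ F (Module.Dual F U)) :=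
  {z | rk F (contract F z.2.rep z.1.rep) ≤ r}

/-- The inclusion `U ⊗ V ⊗ W → U ⊗ L ⊗ L` for subspaces `V`, `W` of `L`. -/
def padding {L : Type*} [AddCommGroup L] [Module F L] (V W : Submodule F L) :
    U ⊗[F] (V ⊗[F] W) →ₗ[F] U ⊗[F] (L ⊗[F] L) :=
  TensorProduct.map LinearMap.id (TensorProduct.map V.subtype W.subtype)

/-- The orbit of `T` under the standard action of `GL(U) × GL(V) × GL(W)`. -/
def orbit {U V W : Type*} [AddCommGroup U] [Module F U] [AddCommGroup V] [Module F V]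
    [AddCommGroup W] [Module F W] (T : U ⊗[F] (V ⊗[F] W)) : Set (U ⊗[F] (V ⊗[F] W)) :=
  Set.range fun g : (U ≃ₗ[F] U) × (V ≃ₗ[F] V) × (W ≃ₗ[F] W) =>
    TensorProduct.map g.1.toLinearMap
      (TensorProduct.map g.2.1.toLinearMap g.2.2.toLinearMap) T

end Tensors

/-- Index set of the basis `e_{ij}` of `L = L_1 ⊕ ⋯ ⊕ L_k` with `dim L_1 = r` and
`dim L_i = n` for `i > 1` (indices are counted from `0`). -/
abbrev BlockIndex (k n r : ℕ) : Type :=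
  Σ i : Fin k, Fin (if (i : ℕ) = 0 then r else n)

theorem card_blockIndex (k n r : ℕ) (hk : 1 ≤ k) :
    Fintype.card (BlockIndex k n r) = (k - 1) * n + r := by
  obtain ⟨m, rfl⟩ : ∃ m, k = m + 1 := ⟨k - 1, by omega⟩
  simp [Fin.sum_univ_succ, add_comm]

/-- The tensor `T_{k,n,r} = ∑ᵢ eᵢ ⊗ ∑ⱼ eᵢⱼ ⊗ eᵢⱼ`, with respect to a basis `e_i` of `U` and a
basis `e_{ij}` of `L`. -/
def blockTensor (F : Type*) [Field F] {U L : Type*} [AddCommGroup U] [Module F U]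
    [AddCommGroup L] [Module F L] {k n r : ℕ} (bU : Module.Basis (Fin k) F U)
    (bL : Module.Basis (BlockIndex k n r) F L) : U ⊗[F] (L ⊗[F] L) :=
  ∑ i : Fin k, bU i ⊗ₜ[F] ∑ j : Fin (if (i : ℕ) = 0 then r else n),
    bL ⟨i, j⟩ ⊗ₜ[F] bL ⟨i, j⟩

end Minrank

end

/-!
Since `T x` is bilinear in `(T, x)`, the minors of `T x` of size `r + 1` are bihomogeneous in
`([T], [x])` and cut out the incidence variety. Projections along projective spaces are closed: for
fixed `T`, homogeneous equations in `x` have no nonzero common zero if and only if, by the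
Nullstellensatz, they generate all monomials of some degree `d`, that is, if and only if some
maximal minor of their Macaulay matrix in degree `d` does not vanish; these minors are homogeneous
polynomials in `T`. The affine minrank variety is the cone over the projected variety.

For the orbit closure, `T_{k,n,r}` lies in the closed, `GL`-invariant minrank variety. Conversely,
if `rk (T x) ≤ r`, choose a basis of `U` with `x` as its first coordinate. Decompositions of the
slices of `T` into at most `r` (first slice) or `n` (other slices) simple tensors exhibit `T` as the
image of `T_{k,n,r}` under `g ⊗ B ⊗ C` with `g` invertible and `B`, `C` arbitrary endomorphisms
of `L`. This image is the value at `t = 0` of the polynomial curve given by `B + t • 1` and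
`C + t • 1`, which stays in the orbit for all but finitely many `t`.
-/

noncomputable section

namespace Minrank

section Minors

variable {F N ι κ J : Type*} [Field F] [AddCommGroup N] [Module F N]

theorem exists_det_ne_zero_of_span_eq_top [Fintype J] [DecidableEq J] (v : ι → J → F)
    (hv : Submodule.span F (Set.range v) = ⊤) : ∃ c : J → ι, (Matrix.of (v ∘ c)).det ≠ 0 := by
  obtain ⟨ι', a, -, hspan, hli⟩ := exists_linearIndependent' F v
  let b := Module.Basis.mk hli (by rw [hspan, hv])
  let e : J ≃ ι' := (Pi.basisFun F J).indexEquiv b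
  have hrows : LinearIndependent F (Matrix.of (v ∘ a ∘ e)).row := hli.comp e e.injective
  rw [Matrix.linearIndependent_rows_iff_isUnit, Matrix.isUnit_iff_isUnit_det] at hrows
  exact ⟨a ∘ e, hrows.ne_zero⟩

theorem linearIndependent_of_det_ne_zero [Fintype J] [DecidableEq J] {w : J → N}
    {φ : J → Module.Dual F N} (h : (Matrix.of fun i j => φ j (w i)).det ≠ 0) :
    LinearIndependent F w := by
  have hrows : LinearIndependent F (Matrix.of fun i j => φ j (w i)).row := by
    rw [Matrix.linearIndependent_rows_iff_isUnit, Matrix.isUnit_iff_isUnit_det]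
    exact h.isUnit
  exact LinearIndependent.of_comp (LinearMap.pi φ) hrows

theorem exists_det_ne_zero_of_linearIndependent [Fintype J] [DecidableEq J] {w : J → N}
    (hw : LinearIndependent F w) {φ : κ → Module.Dual F N}
    (hφ : ∀ y, (∀ k, φ k y = 0) → y = 0) :
    ∃ d : J → κ, (Matrix.of fun i j => φ (d j) (w i)).det ≠ 0 := by
  have hspan : Submodule.span F (Set.range fun k i => φ k (w i)) = ⊤ := by
    by_contra hne
    obtain ⟨l, hl, hker⟩ := Submodule.exists_le_ker_of_lt_top _ (lt_top_iff_ne_top.mpr hne)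
    have hrel : ∑ i, l (Pi.single i 1) • w i = 0 := hφ _ fun k => by
      have hk : l (fun i => φ k (w i)) = 0 := hker (Submodule.subset_span ⟨k, rfl⟩)
      rw [← hk, ← (Pi.basisFun F J).sum_repr fun i => φ k (w i)]
      simp [mul_comm]
    refine hl ((Pi.basisFun F J).ext fun i => ?_)
    simpa using Fintype.linearIndependent_iff.mp hw _ hrel i
  obtain ⟨d, hd⟩ := exists_det_ne_zero_of_span_eq_top _ hspan
  exact ⟨d, by rwa [← Matrix.det_transpose]⟩

theorem le_finrank_span_range_iff_exists_minor (v : ι → N)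
    [FiniteDimensional F (Submodule.span F (Set.range v))] {φ : κ → Module.Dual F N}
    (hφ : ∀ y, (∀ k, φ k y = 0) → y = 0) (m : ℕ) :
    m ≤ Module.finrank F (Submodule.span F (Set.range v)) ↔
      ∃ (c : Fin m → ι) (d : Fin m → κ), (Matrix.of fun i j => φ (d j) (v (c i))).det ≠ 0 := by
  constructor
  · intro hm
    obtain ⟨f, hf, -, hli⟩ := Submodule.exists_fun_fin_finrank_span_eq F (Set.range v)
    choose c hc using hf
    obtain rfl : v ∘ c = f := funext hc
    obtain ⟨d, hd⟩ := exists_det_ne_zero_of_linearIndependent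
      (hli.comp _ (Fin.castLE_injective hm)) hφ
    exact ⟨c ∘ Fin.castLE hm, d, hd⟩
  · rintro ⟨c, d, hdet⟩
    have hli : LinearIndependent F (v ∘ c) := linearIndependent_of_det_ne_zero hdet
    rw [← Fintype.card_fin m, ← finrank_span_eq_card hli]
    exact Submodule.finrank_mono (Submodule.span_mono (Set.range_comp_subset_range c v))

theorem isWeightedHomogeneous_det {R σ M : Type*} [CommRing R] [AddCommMonoid M] [Fintype J]
    [DecidableEq J] {w : σ → M} {m : J → M} {A : Matrix J J (MvPolynomial σ R)}
    (hA : ∀ i j, (A i j).IsWeightedHomogeneous w (m i)) :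
    A.det.IsWeightedHomogeneous w (∑ i, m i) := by
  rw [Matrix.det_apply]
  refine MvPolynomial.IsWeightedHomogeneous.sum _ _ _ fun s _ => ?_
  have hprod : (∏ i, A (s i) i).IsWeightedHomogeneous w (∑ i, m i) := by
    rw [← Equiv.sum_comp s m]
    exact MvPolynomial.IsWeightedHomogeneous.prod _ _ _ fun i _ => hA (s i) i
  rcases Int.units_eq_one_or (Equiv.Perm.sign s) with hs | hs
  · simpa [hs] using hprod
  · simpa [hs] using hprod.neg

end Minors

section Elimination

open MvPolynomial
open scoped Pointwise

variable {R F σ ι : Type*} [CommRing R] [Field F]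

/-- The exponents of the monomials of degree `d` in variables indexed by `σ`. -/
abbrev DegreeExponent (σ : Type*) (d : ℕ) : Type _ := {j : σ →₀ ℕ // j.degree = d}

instance DegreeExponent.fintype [Finite σ] (d : ℕ) : Fintype (DegreeExponent σ d) :=
  (Finsupp.finite_of_degree_eq d).fintype

/-- The row of the Macaulay matrix of the family `P` in degree `d` that belongs to the multiple
`X ^ a.1 * P a.2`: its entries are the coefficients at the monomials of degree `d`. -/
def macaulayRow (P : ι → MvPolynomial σ R) (d : ℕ) (a : (σ →₀ ℕ) × ι) :
    DegreeExponent σ d → R :=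
  fun j => coeff j.1 (monomial a.1 1 * P a.2)

/-- The maximal minor of the Macaulay matrix of `P` in degree `d` with rows `c`. -/
def macaulayMinor [Finite σ] [DecidableEq σ] (P : ι → MvPolynomial σ R) (d : ℕ)
    (c : DegreeExponent σ d → (σ →₀ ℕ) × ι) : R :=
  (Matrix.of (macaulayRow P d ∘ c)).det

theorem map_macaulayMinor {S : Type*} [CommRing S] [Finite σ] [DecidableEq σ] (f : R →+* S)
    (P : ι → MvPolynomial σ R) (d : ℕ) (c : DegreeExponent σ d → (σ →₀ ℕ) × ι) :
    f (macaulayMinor P d c) = macaulayMinor (fun i => map f (P i)) d c := by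
  rw [macaulayMinor, RingHom.map_det]
  refine congrArg Matrix.det (Matrix.ext fun i j => ?_)
  simp [macaulayRow, coeff_monomial_mul', coeff_map, apply_ite f]

theorem isHomogeneous_macaulayMinor {τ : Type*} [Finite σ] [DecidableEq σ]
    {P : ι → MvPolynomial σ (MvPolynomial τ R)} {n : ι → ℕ}
    (hP : ∀ i j, (coeff j (P i)).IsHomogeneous (n i)) (d : ℕ)
    (c : DegreeExponent σ d → (σ →₀ ℕ) × ι) :
    (macaulayMinor P d c).IsHomogeneous (∑ k, n (c k).2) := by
  refine isWeightedHomogeneous_det fun k j => ?_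
  simp only [Matrix.of_apply, Function.comp_apply, macaulayRow, coeff_monomial_mul', one_mul]
  split_ifs
  · exact hP _ _
  · exact isHomogeneous_zero _ _ _

theorem eval_homogeneousComponent [Finite σ] (x : σ → R) (d : ℕ) (q : MvPolynomial σ R) :
    eval x (homogeneousComponent d q) =
      ∑ j : DegreeExponent σ d, coeff j.1 q * j.1.prod fun s n => x s ^ n := by
  rw [homogeneousComponent_apply, map_sum, Finset.sum_subset (s₂ := Finset.univ.map
    (Function.Embedding.subtype fun j : σ →₀ ℕ => j.degree = d)), Finset.sum_map]
  · simp only [eval_monomial, Function.Embedding.subtype_apply]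
  · intro j hj
    simpa using (Finset.mem_filter.mp hj).2
  · intro j hj hj'
    have hcoeff : coeff j q = 0 := by
      by_contra hne
      exact hj' (Finset.mem_filter.mpr ⟨mem_support_iff.mpr hne, by simpa using hj⟩)
    rw [hcoeff, monomial_zero, map_zero]

theorem macaulayRow_dotProduct_eq_zero [Finite σ] {P : ι → MvPolynomial σ R} {m : ι → ℕ}
    (hP : ∀ i, (P i).IsHomogeneous (m i)) {x : σ → R} (hx : ∀ i, eval x (P i) = 0) (d : ℕ)
    (a : (σ →₀ ℕ) × ι) :
    (macaulayRow P d a) ⬝ᵥ (fun j => j.1.prod fun s n => x s ^ n) = 0 := by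
  have hmul : (monomial a.1 1 * P a.2).IsHomogeneous (a.1.degree + m a.2) :=
    (isHomogeneous_monomial _ rfl).mul (hP _)
  refine (eval_homogeneousComponent x d _).symm.trans ?_
  rw [homogeneousComponent_of_mem hmul]
  split_ifs
  · rw [map_mul, hx, mul_zero]
  · exact map_zero _

theorem span_range_macaulayRow_eq_top [Finite σ] {P : ι → MvPolynomial σ R} {d : ℕ}
    (hP : idealOfVars σ R ^ d ≤ Ideal.span (Set.range P)) :
    Submodule.span R (Set.range (macaulayRow P d)) = ⊤ := by
  classical
  nontriviality R
  let π : MvPolynomial σ R →ₗ[R] DegreeExponent σ d → R := LinearMap.pi fun j => lcoeff R j.1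
  have hrange : Set.range (macaulayRow P d) =
      π '' (Set.range (basisMonomials σ R) • Set.range P) := by
    rw [← Set.image2_smul, Set.image2_range, ← Set.range_comp]
    rfl
  rw [hrange, Submodule.span_image, Submodule.span_smul_of_span_eq_top (Module.Basis.span_eq _),
    eq_top_iff, ← (Pi.basisFun R _).span_eq, Submodule.span_le]
  rintro _ ⟨j, rfl⟩
  refine ⟨monomial j.1 1, hP ((monomial_mem_pow_idealOfVars_iff d j.1 one_ne_zero).mpr j.2.ge),
    funext fun j' => ?_⟩
  simp [π, Pi.single_apply, coeff_monomial, Subtype.ext_iff, eq_comm]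

variable [IsAlgClosed F]

theorem exists_pow_idealOfVars_le [Finite σ] {P : ι → MvPolynomial σ F}
    (h : ∀ x : σ → F, (∀ i, eval x (P i) = 0) → x = 0) :
    ∃ d, idealOfVars σ F ^ d ≤ Ideal.span (Set.range P) := by
  refine Ideal.exists_pow_le_of_le_radical_of_fg ?_ (idealOfVars_fg σ F)
  rw [← vanishingIdeal_zeroLocus_eq_radical (K := F), idealOfVars, Ideal.span_le]
  rintro _ ⟨s, rfl⟩
  rw [SetLike.mem_coe, mem_vanishingIdeal_iff]
  intro x hx
  have hx0 : x = 0 := h x fun i => hx _ (Ideal.subset_span ⟨i, rfl⟩)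
  simp [hx0]

theorem exists_ne_zero_forall_eval_eq_zero_iff [Finite σ] [DecidableEq σ]
    {P : ι → MvPolynomial σ F} {m : ι → ℕ} (hP : ∀ i, (P i).IsHomogeneous (m i)) :
    (∃ x : σ → F, x ≠ 0 ∧ ∀ i, eval x (P i) = 0) ↔ ∀ d c, macaulayMinor P d c = 0 := by
  constructor
  · rintro ⟨x, hx, hPx⟩ d c
    rw [macaulayMinor, ← Matrix.exists_mulVec_eq_zero_iff]
    refine ⟨fun j => j.1.prod fun s n => x s ^ n, ?_,
      funext fun k => macaulayRow_dotProduct_eq_zero hP hPx d (c k)⟩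
    obtain ⟨s, hs⟩ := Function.ne_iff.mp hx
    refine Function.ne_iff.mpr ⟨⟨Finsupp.single s d, by simp⟩, ?_⟩
    simpa using fun h => absurd h hs
  · contrapose!
    intro h
    obtain ⟨d, hd⟩ := exists_pow_idealOfVars_le fun x hx => by
      by_contra hx0
      obtain ⟨i, hi⟩ := h x hx0
      exact hi (hx i)
    exact ⟨d, exists_det_ne_zero_of_span_eq_top _ (span_range_macaulayRow_eq_top hd)⟩

end Elimination

section Bihomogeneous

open MvPolynomial

theorem aeval_mem_of_isWeightedHomogeneous {R A M σ : Type*} [CommSemiring R] [CommSemiring A]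
    [Algebra R A] [AddCommMonoid M] (𝒢 : M → Submodule R A) [SetLike.GradedMonoid 𝒢] {w : σ → M}
    {f : σ → A} (hf : ∀ s, f s ∈ 𝒢 (w s)) {p : MvPolynomial σ R} {m : M}
    (hp : p.IsWeightedHomogeneous w m) : aeval f p ∈ 𝒢 m := by
  rw [aeval_def, eval₂_eq]
  refine Submodule.sum_mem _ fun j hj => ?_
  rw [← Algebra.smul_def, ← hp (mem_support_iff.mp hj), Finsupp.weight_apply]
  exact Submodule.smul_mem _ _ (SetLike.prod_pow_mem_graded 𝒢 _ _ _ fun s _ => hf s)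

theorem eval_smul_of_isHomogeneous {R σ : Type*} [CommSemiring R] {p : MvPolynomial σ R} {d : ℕ}
    (hp : p.IsHomogeneous d) (c : R) (x : σ → R) : eval (c • x) p = c ^ d * eval x p := by
  rw [eval_eq, eval_eq, Finset.mul_sum]
  refine Finset.sum_congr rfl fun j hj => ?_
  have hdeg : ∑ i ∈ j.support, j i = d := by
    rw [← hp (mem_support_iff.mp hj)]
    simp [Finsupp.weight_apply, Finsupp.sum]
  simp only [Pi.smul_apply, smul_eq_mul, mul_pow, Finset.prod_mul_distrib,
    Finset.prod_pow_eq_pow_sum, hdeg]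
  ring

/-- The polynomials in the variables `σ` over `MvPolynomial τ R` that are homogeneous of degree
`d.2` in `σ` with coefficients homogeneous of degree `d.1` in `τ`. -/
def bihomogeneousSubmodule (R σ τ : Type*) [CommSemiring R] (d : ℕ × ℕ) :
    Submodule R (MvPolynomial σ (MvPolynomial τ R)) where
  carrier := {q | (∀ j, (coeff j q).IsHomogeneous d.1) ∧ q.IsHomogeneous d.2}
  zero_mem' := ⟨fun _ => isHomogeneous_zero _ _ _, isHomogeneous_zero _ _ _⟩
  add_mem' hp hq := ⟨fun j => (hp.1 j).add (hq.1 j), hp.2.add hq.2⟩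
  smul_mem' c q hq := ⟨fun j => (homogeneousSubmodule τ R d.1).smul_mem c (hq.1 j), by
    rw [← algebraMap_smul (MvPolynomial τ R) c q]
    exact (homogeneousSubmodule σ _ d.2).smul_mem _ hq.2⟩

instance bihomogeneousSubmodule.gradedMonoid (R σ τ : Type*) [CommSemiring R] :
    SetLike.GradedMonoid (bihomogeneousSubmodule R σ τ) where
  one_mem := by
    classical
    refine ⟨fun j => ?_, isHomogeneous_one _ _⟩
    rw [coeff_one]
    split_ifs
    exacts [isHomogeneous_one _ _, isHomogeneous_zero _ _ _]
  mul_mem _ _ p q hp hq := by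
    classical
    refine ⟨fun j => ?_, hp.2.mul hq.2⟩
    rw [coeff_mul]
    exact IsHomogeneous.sum _ _ _ fun a _ => (hp.1 a.1).mul (hq.1 a.2)

variable {F E E' κ : Type*} [Field F] [AddCommGroup E] [Module F E] [AddCommGroup E'] [Module F E']
  [Fintype κ]

/-- A polynomial on `E × E'` as a polynomial in the coordinates of `E'` with respect to `b`, whose
coefficients are polynomials on `E`. -/
def fiberPolynomial (b : Module.Basis κ F E') :
    MvPolynomial (Module.Dual F E ⊕ Module.Dual F E') F →ₐ[F]
      MvPolynomial κ (MvPolynomial (Module.Dual F E) F) :=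
  aeval (Sum.elim (fun φ => C (X φ)) fun ψ => ∑ i, C (C (ψ (b i))) * X i)

theorem eval_map_fiberPolynomial (b : Module.Basis κ F E')
    (p : MvPolynomial (Module.Dual F E ⊕ Module.Dual F E') F) (v : E) (x : κ → F) :
    eval x (map (eval fun φ : Module.Dual F E => φ v) (fiberPolynomial b p)) =
      eval (Sum.elim (fun φ : Module.Dual F E => φ v)
        fun ψ : Module.Dual F E' => ψ (b.equivFun.symm x)) p := by
  induction p using MvPolynomial.induction_on with
  | C c => simp [fiberPolynomial, MvPolynomial.algebraMap_apply]
  | add p q hp hq => simp only [map_add, hp, hq]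
  | mul_X p s hp =>
    rw [map_mul, map_mul, map_mul, map_mul, hp]
    rcases s with φ | ψ
    · simp [fiberPolynomial]
    · simp [fiberPolynomial, Module.Basis.equivFun_symm_apply, mul_comm]

theorem fiberPolynomial_mem_bihomogeneousSubmodule (b : Module.Basis κ F E')
    {p : MvPolynomial (Module.Dual F E ⊕ Module.Dual F E') F} {d : ℕ × ℕ}
    (hp : IsBihomogeneous F p d) :
    fiberPolynomial b p ∈ bihomogeneousSubmodule F κ (Module.Dual F E) d := by
  classical
  refine aeval_mem_of_isWeightedHomogeneous _ ?_ hp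
  rintro (φ | ψ)
  · refine ⟨fun j => ?_, isHomogeneous_C _ _⟩
    rw [Sum.elim_inl, coeff_C]
    split_ifs
    exacts [isHomogeneous_X _ _, isHomogeneous_zero _ _ _]
  · refine Submodule.sum_mem _ fun i _ => ⟨fun j => ?_, isHomogeneous_C_mul_X _ _⟩
    rw [coeff_C_mul, coeff_X]
    split_ifs
    · simpa using isHomogeneous_C _ _
    · simpa using isHomogeneous_zero _ _ _

end Bihomogeneous

section Zariski

open MvPolynomial

variable {F E E' : Type*} [Field F] [AddCommGroup E] [Module F E] [AddCommGroup E'] [Module F E']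

theorem polyEval_smul {p : MvPolynomial (Module.Dual F E) F} {d : ℕ} (hp : p.IsHomogeneous d)
    (c : F) (v : E) : polyEval F p (c • v) = c ^ d * polyEval F p v := by
  rw [polyEval, polyEval, ← eval_smul_of_isHomogeneous hp]
  exact congrArg (eval · p) (funext fun φ => map_smul φ c v)

theorem polyEval_rep_mk_eq_zero_iff {p : MvPolynomial (Module.Dual F E) F} {d : ℕ}
    (hp : p.IsHomogeneous d) {v : E} (hv : v ≠ 0) :
    polyEval F p (Projectivization.mk F v hv).rep = 0 ↔ polyEval F p v = 0 := by
  obtain ⟨a, ha⟩ := Projectivization.exists_smul_eq_mk_rep F v hv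
  rw [← ha, Units.smul_def, polyEval_smul hp]
  simp

theorem zariskiClosure_subset {A Z : Set E} (hZ : IsZariskiClosed F Z) (h : A ⊆ Z) :
    zariskiClosure F A ⊆ Z :=
  Set.sInter_subset_of_mem ⟨hZ, h⟩

theorem isZariskiClosed_empty : IsZariskiClosed F (∅ : Set E) :=
  ⟨{1}, by simp [polyEval]⟩

theorem IsProjClosed.isZariskiClosed_affineCone {Z : Set (ℙ F E)} (hZ : IsProjClosed F Z) :
    IsZariskiClosed F (affineCone F Z) := by
  obtain ⟨S, hS, rfl⟩ := hZ
  -- Multiplying by linear forms puts the origin into the zero locus, whatever the degree of `p`.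
  refine ⟨{q | ∃ p ∈ S, ∃ φ : Module.Dual F E, q = p * X φ}, ?_⟩
  ext v
  simp only [Set.mem_ofPred_eq]
  constructor
  · rintro hv _ ⟨p, hp, φ, rfl⟩
    rw [polyEval, map_mul, eval_X, mul_eq_zero]
    by_cases hv0 : v = 0
    · exact .inr (by rw [hv0, map_zero])
    · obtain ⟨d, hd⟩ := hS p hp
      exact .inl ((polyEval_rep_mk_eq_zero_iff hd hv0).mp (hv hv0 p hp))
  · intro hv hv0 p hp
    obtain ⟨d, hd⟩ := hS p hp
    obtain ⟨φ, hφ⟩ : ∃ φ : Module.Dual F E, φ v ≠ 0 := by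
      by_contra! h
      exact hv0 ((Module.forall_dual_apply_eq_zero_iff F v).mp h)
    have hmul : polyEval F p v * φ v = 0 := by
      simpa [polyEval] using hv _ ⟨p, hp, φ, rfl⟩
    exact (polyEval_rep_mk_eq_zero_iff hd hv0).mpr ((mul_eq_zero_iff_right hφ).mp hmul)

theorem eval_rep_mk_eq_zero_iff {κ : Type*} [Fintype κ] (b : Module.Basis κ F E')
    {p : MvPolynomial (Module.Dual F E ⊕ Module.Dual F E') F} {d : ℕ × ℕ}
    (hp : IsBihomogeneous F p d) (v : E) {w : E'} (hw : w ≠ 0) :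
    eval (Sum.elim (fun φ : Module.Dual F E => φ v)
        fun ψ : Module.Dual F E' => ψ (Projectivization.mk F w hw).rep) p = 0 ↔
      eval (b.equivFun w)
        (map (eval fun φ : Module.Dual F E => φ v) (fiberPolynomial b p)) = 0 := by
  obtain ⟨a, ha⟩ := Projectivization.exists_smul_eq_mk_rep F w hw
  rw [← b.equivFun.symm_apply_apply (Projectivization.mk F w hw).rep, ← eval_map_fiberPolynomial,
    ← ha, Units.smul_def, map_smul,
    eval_smul_of_isHomogeneous ((fiberPolynomial_mem_bihomogeneousSubmodule b hp).2.map _)]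
  simp

theorem IsBiprojClosed.isProjClosed_image_fst [IsAlgClosed F] [FiniteDimensional F E']
    {Z : Set (ℙ F E × ℙ F E')} (hZ : IsBiprojClosed F Z) : IsProjClosed F (Prod.fst '' Z) := by
  classical
  obtain ⟨S, hS, rfl⟩ := hZ
  choose! d hd using hS
  let b := Module.finBasis F E'
  let P (p : S) := fiberPolynomial (E := E) b p.1
  have hP (p : S) := fiberPolynomial_mem_bihomogeneousSubmodule b (hd p p.2)
  refine ⟨{q | ∃ e c, q = macaulayMinor P e c}, ?_, ?_⟩
  · rintro _ ⟨e, c, rfl⟩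
    exact ⟨_, isHomogeneous_macaulayMinor (fun p => (hP p).1) e c⟩
  ext t
  let ev := eval fun φ : Module.Dual F E => φ t.rep
  have hfiber : t ∈ Prod.fst '' {z : ℙ F E × ℙ F E' | ∀ p ∈ S, eval (Sum.elim
      (fun φ : Module.Dual F E => φ z.1.rep) fun ψ : Module.Dual F E' => ψ z.2.rep) p = 0} ↔
      ∃ x ≠ 0, ∀ p, eval x (map ev (P p)) = 0 := by
    constructor
    · rintro ⟨⟨_, z⟩, hz, rfl⟩
      induction z with | h w hw => ?_
      exact ⟨b.equivFun w, by simpa using hw, fun p =>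
        (eval_rep_mk_eq_zero_iff b (hd p p.2) _ hw).mp (hz p p.2)⟩
    · rintro ⟨x, hx, h⟩
      obtain ⟨w, rfl⟩ := b.equivFun.surjective x
      have hw : w ≠ 0 := by simpa using hx
      exact ⟨(t, .mk F w hw), fun p hp =>
        (eval_rep_mk_eq_zero_iff b (hd p hp) _ hw).mpr (h ⟨p, hp⟩), rfl⟩
  rw [hfiber, exists_ne_zero_forall_eval_eq_zero_iff fun p => (hP p).2.map ev]
  simp only [← map_macaulayMinor]
  exact ⟨by rintro h _ ⟨e, c, rfl⟩; exact h e c, fun h e c => h _ ⟨e, c, rfl⟩⟩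

theorem mem_zariskiClosure_of_infinite {A : Set E} (γ : F → E)
    (hγ : ∀ φ : Module.Dual F E, ∃ q : Polynomial F, ∀ t, q.eval t = φ (γ t))
    (hA : {t | γ t ∈ A}.Infinite) (t : F) : γ t ∈ zariskiClosure F A := by
  rintro _ ⟨⟨S, rfl⟩, hS⟩ p hp
  choose q hq using hγ
  let Q : Polynomial F := aeval q p
  have hQ (s : F) : Q.eval s = polyEval F p (γ s) := by
    have hcomp : (Polynomial.aeval s).comp (aeval q) =
        aeval (R := F) fun φ : Module.Dual F E => φ (γ s) := by
      ext φ
      simp [hq]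
    simpa [polyEval, aeval_eq_eval] using DFunLike.congr_fun hcomp p
  have hQ0 : Q = 0 := Polynomial.eq_zero_of_infinite_isRoot Q <|
    hA.mono fun s hs => (hQ s).trans (hS hs p hp)
  rw [← hQ, hQ0, Polynomial.eval_zero]

end Zariski

section Contraction

variable {F U V W M U' V' W' M' ι κ μ : Type*} [Field F]
  [AddCommGroup U] [Module F U] [AddCommGroup V] [Module F V] [AddCommGroup W] [Module F W]
  [AddCommGroup M] [Module F M] [AddCommGroup U'] [Module F U'] [AddCommGroup V'] [Module F V']
  [AddCommGroup W'] [Module F W'] [AddCommGroup M'] [Module F M']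

@[simp]
theorem contract_tmul (x : Module.Dual F U) (u : U) (m : M) :
    contract F x (u ⊗ₜ[F] m) = x u • m := by
  simp [contract]

theorem contract_map (x : Module.Dual F U') (f : U →ₗ[F] U') (g : M →ₗ[F] M') (T : U ⊗[F] M) :
    contract F x (TensorProduct.map f g T) = g (contract F (x ∘ₗ f) T) := by
  induction T with
  | zero => simp only [map_zero]
  | tmul u m => simp
  | add T T' h h' => simp only [map_add, h, h']

theorem exists_finsupp_eq_sum_basis_tmul (b : Module.Basis ι F U) (T : U ⊗[F] M) :
    ∃ c : ι →₀ M, (∀ i, contract F (b.coord i) T = c i) ∧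
      T = c.sum fun i m => b i ⊗ₜ[F] m := by
  classical
  refine ⟨TensorProduct.equivFinsuppOfBasisLeft b T,
    fun i => (TensorProduct.equivFinsuppOfBasisLeft_apply b T i).symm, ?_⟩
  rw [← TensorProduct.equivFinsuppOfBasisLeft_symm_apply, LinearEquiv.symm_apply_apply]

theorem sum_basis_tmul_contract [Fintype ι] (b : Module.Basis ι F U) (T : U ⊗[F] M) :
    ∑ i, b i ⊗ₜ[F] contract F (b.coord i) T = T := by
  obtain ⟨c, hc, hT⟩ := exists_finsupp_eq_sum_basis_tmul b T
  simp only [hc]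
  rw [hT, c.sum_fintype _ fun i => TensorProduct.tmul_zero _ (b i)]

theorem contract_eq_sum [Fintype ι] (b : Module.Basis ι F U) (x : Module.Dual F U)
    (T : U ⊗[F] M) : contract F x T = ∑ i, x (b i) • contract F (b.coord i) T := by
  conv_lhs => rw [← sum_basis_tmul_contract b T, map_sum]
  simp only [contract_tmul]

theorem range_flip_contract_eq_span (b : Module.Basis κ F V) (A : V ⊗[F] W) :
    LinearMap.range ((contract F).flip A) =
      Submodule.span F (Set.range fun k => contract F (b.coord k) A) := by
  apply le_antisymm
  · rintro _ ⟨x, rfl⟩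
    obtain ⟨c, hc, hA⟩ := exists_finsupp_eq_sum_basis_tmul b A
    have hx : contract F x A = c.sum fun k w => x (b k) • w := by
      conv_lhs => rw [hA, map_finsuppSum]
      simp only [contract_tmul]
    rw [LinearMap.flip_apply, hx]
    exact Submodule.sum_mem _ fun k _ =>
      Submodule.smul_mem _ _ (Submodule.subset_span ⟨k, hc k⟩)
  · rw [Submodule.span_le]
    rintro _ ⟨k, rfl⟩
    exact ⟨b.coord k, rfl⟩

theorem range_flip_contract_sum_tmul_le [Fintype ι] (v : ι → V) (w : ι → W) :
    LinearMap.range ((contract F).flip (∑ i, v i ⊗ₜ[F] w i)) ≤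
      Submodule.span F (Set.range w) := by
  rintro _ ⟨x, rfl⟩
  rw [LinearMap.flip_apply, map_sum]
  refine Submodule.sum_mem _ fun i _ => ?_
  rw [contract_tmul]
  exact Submodule.smul_mem _ _ (Submodule.subset_span ⟨i, rfl⟩)

instance finiteDimensional_range_flip_contract (A : V ⊗[F] W) :
    FiniteDimensional F (LinearMap.range ((contract F).flip A)) := by
  obtain ⟨n, v, w, rfl⟩ := TensorProduct.exists_sum_tmul_eq A
  have := FiniteDimensional.span_of_finite F (Set.finite_range w)
  exact Submodule.finiteDimensional_of_le (range_flip_contract_sum_tmul_le v w)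

theorem rk_sum_tmul_le [Fintype ι] (v : ι → V) (w : ι → W) :
    rk F (∑ i, v i ⊗ₜ[F] w i) ≤ Fintype.card ι :=
  have := FiniteDimensional.span_of_finite F (Set.finite_range w)
  (Submodule.finrank_mono (range_flip_contract_sum_tmul_le v w)).trans (finrank_range_le_card w)

theorem rk_le_finrank_left [FiniteDimensional F V] (A : V ⊗[F] W) :
    rk F A ≤ Module.finrank F V :=
  (LinearMap.finrank_range_le _).trans Subspace.dual_finrank_eq.le

theorem range_flip_contract_map_le (f : V →ₗ[F] V') (g : W →ₗ[F] W') (A : V ⊗[F] W) :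
    LinearMap.range ((contract F).flip (TensorProduct.map f g A)) ≤
      (LinearMap.range ((contract F).flip A)).map g := by
  rintro _ ⟨x, rfl⟩
  exact ⟨_, ⟨x ∘ₗ f, rfl⟩, (contract_map x f g A).symm⟩

theorem rk_map_le (f : V →ₗ[F] V') (g : W →ₗ[F] W') (A : V ⊗[F] W) :
    rk F (TensorProduct.map f g A) ≤ rk F A :=
  (Submodule.finrank_mono (range_flip_contract_map_le f g A)).trans (Submodule.finrank_map_le _ _)

theorem rk_map_of_injective {f : V →ₗ[F] V'} {g : W →ₗ[F] W'} (hf : Function.Injective f)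
    (hg : Function.Injective g) (A : V ⊗[F] W) : rk F (TensorProduct.map f g A) = rk F A := by
  have hrange : LinearMap.range ((contract F).flip (TensorProduct.map f g A)) =
      (LinearMap.range ((contract F).flip A)).map g := by
    refine (range_flip_contract_map_le f g A).antisymm ?_
    rintro _ ⟨_, ⟨y, rfl⟩, rfl⟩
    obtain ⟨x, rfl⟩ := LinearMap.dualMap_surjective_of_injective hf y
    exact ⟨x, contract_map x f g A⟩
  rw [rk, hrange]
  exact (Submodule.equivMapOfInjective g hg _).finrank_eq.symm

theorem rk_smul_le (c : F) (A : V ⊗[F] W) : rk F (c • A) ≤ rk F A := by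
  simpa [TensorProduct.map_smul_right] using rk_map_le (.id : V →ₗ[F] V) (c • .id : W →ₗ[F] W) A

theorem mem_range_map_subtype {S : Submodule F W} {A : V ⊗[F] W}
    (hA : LinearMap.range ((contract F).flip A) ≤ S) :
    A ∈ LinearMap.range (TensorProduct.map (.id : V →ₗ[F] V) S.subtype) := by
  let b := Module.Basis.ofVectorSpace F V
  obtain ⟨c, hc, hsum⟩ := exists_finsupp_eq_sum_basis_tmul b A
  rw [hsum]
  refine Submodule.sum_mem _ fun k _ => ?_
  exact ⟨b k ⊗ₜ ⟨c k, hA ⟨b.coord k, hc k⟩⟩, by simp⟩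

theorem exists_eq_sum_tmul_basis [Fintype ι] {S : Submodule F W} (c : Module.Basis ι F S)
    {A : V ⊗[F] W} (hA : LinearMap.range ((contract F).flip A) ≤ S) :
    ∃ v : ι → V, A = ∑ i, v i ⊗ₜ[F] (c i : W) := by
  obtain ⟨A', rfl⟩ := mem_range_map_subtype hA
  obtain ⟨v, rfl⟩ := TensorProduct.eq_repr_basis_right c A'
  refine ⟨v, ?_⟩
  rw [v.sum_fintype _ fun i => TensorProduct.zero_tmul _ (c i), map_sum]
  simp only [TensorProduct.map_tmul, LinearMap.id_apply, Submodule.subtype_apply]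

theorem exists_eq_sum_tmul_of_rk_le [Fintype ι] (A : V ⊗[F] W) (hA : rk F A ≤ Fintype.card ι) :
    ∃ (v : ι → V) (w : ι → W), A = ∑ i, v i ⊗ₜ[F] w i := by
  let c := Module.finBasis F (LinearMap.range ((contract F).flip A))
  obtain ⟨v, hv⟩ := exists_eq_sum_tmul_basis c le_rfl
  obtain ⟨e⟩ : Nonempty (Fin (Module.finrank F (LinearMap.range ((contract F).flip A))) ↪ ι) :=
    Function.Embedding.nonempty_of_card_le (by rwa [Fintype.card_fin])
  refine ⟨Function.extend e v 0, Function.extend e (fun i => (c i : W)) 0, hv.trans ?_⟩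
  refine Fintype.sum_of_injective e e.injective _ _ (fun i hi => ?_) fun i => ?_
  · rw [Function.extend_apply' _ _ _ hi, Pi.zero_apply, TensorProduct.zero_tmul]
  · rw [e.injective.extend_apply, e.injective.extend_apply]

theorem rk_le_iff_forall_minor (bV : Module.Basis κ F V) (bW : Module.Basis μ F W)
    (A : V ⊗[F] W) (r : ℕ) :
    rk F A ≤ r ↔ ∀ (c : Fin (r + 1) → κ) (d : Fin (r + 1) → μ),
      (Matrix.of fun p q => bW.coord (d q) (contract F (bV.coord (c p)) A)).det = 0 := by
  have hrange := range_flip_contract_eq_span bV A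
  have : FiniteDimensional F (Submodule.span F (Set.range fun k => contract F (bV.coord k) A)) :=
    hrange ▸ inferInstance
  have hminor := le_finrank_span_range_iff_exists_minor (fun k => contract F (bV.coord k) A)
    (fun y => (bW.forall_coord_eq_zero_iff).mp) (r + 1)
  rw [← hrange] at hminor
  rw [← Nat.lt_add_one_iff, ← not_le, rk, hminor]
  push Not
  rfl

/-- The coordinate of a tensor in `U ⊗ V ⊗ W` at the triple of indices `(i, k, m)`, as a linear
functional of the tensor. -/
def tensorCoord (bU : Module.Basis ι F U) (bV : Module.Basis κ F V) (bW : Module.Basis μ F W)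
    (i : ι) (k : κ) (m : μ) : Module.Dual F (U ⊗[F] (V ⊗[F] W)) :=
  bW.coord m ∘ₗ contract F (bV.coord k) ∘ₗ contract F (bU.coord i)

theorem rk_contract_le_iff_forall_minor [Fintype ι] (bU : Module.Basis ι F U)
    (bV : Module.Basis κ F V) (bW : Module.Basis μ F W) (x : Module.Dual F U)
    (T : U ⊗[F] (V ⊗[F] W)) (r : ℕ) :
    rk F (contract F x T) ≤ r ↔ ∀ (c : Fin (r + 1) → κ) (d : Fin (r + 1) → μ),
      (Matrix.of fun p q => ∑ i, x (bU i) * tensorCoord bU bV bW i (c p) (d q) T).det = 0 := by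
  rw [rk_le_iff_forall_minor bV bW, contract_eq_sum bU]
  simp only [map_sum, map_smul, smul_eq_mul, tensorCoord, LinearMap.comp_apply]

end Contraction

section Variety

open MvPolynomial

variable {F U V W : Type*} [Field F] [AddCommGroup U] [Module F U] [AddCommGroup V] [Module F V]
  [AddCommGroup W] [Module F W]

theorem setOf_minrank_le (r : ℕ) :
    {T : U ⊗[F] (V ⊗[F] W) | minrank F T ≤ (r : ℕ∞)} = minrankVariety F U V W r := by
  ext T
  rw [Set.mem_ofPred_eq, ← ENat.lt_add_one_iff (ENat.natCast_ne_top r), minrank]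
  simp_rw [iInf_lt_iff, ENat.lt_add_one_iff (ENat.natCast_ne_top r), Nat.cast_le]
  simp [minrankVariety]

theorem smul_mem_minrankVariety {r : ℕ} {T : U ⊗[F] (V ⊗[F] W)}
    (hT : T ∈ minrankVariety F U V W r) (c : F) : c • T ∈ minrankVariety F U V W r := by
  obtain ⟨x, hx, hr⟩ := hT
  refine ⟨x, hx, ?_⟩
  rw [map_smul]
  exact (rk_smul_le c _).trans hr

theorem zero_mem_minrankVariety [Nontrivial U] (r : ℕ) : 0 ∈ minrankVariety F U V W r := by
  obtain ⟨x, hx⟩ := exists_ne (0 : Module.Dual F U)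
  refine ⟨x, hx, ?_⟩
  rw [map_zero, rk, map_zero, LinearMap.range_zero, finrank_bot]
  exact r.zero_le

theorem minrankVariety_eq_empty [Subsingleton U] (r : ℕ) : minrankVariety F U V W r = ∅ :=
  Set.eq_empty_of_forall_notMem fun _ ⟨x, hx, _⟩ => hx (Subsingleton.elim x 0)

theorem isBiprojClosed_projIncidence [FiniteDimensional F U] (r : ℕ) :
    IsBiprojClosed F (projIncidence F U V W r) := by
  let bU := Module.finBasis F U
  let bV := Module.Basis.ofVectorSpace F V
  let bW := Module.Basis.ofVectorSpace F W
  let minor (c : Fin (r + 1) → _) (d : Fin (r + 1) → _) :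
      MvPolynomial (Module.Dual F (U ⊗[F] (V ⊗[F] W)) ⊕ Module.Dual F (Module.Dual F U)) F :=
    (Matrix.of fun p q => ∑ i, X (.inr (Module.Dual.eval F U (bU i))) *
      X (.inl (tensorCoord bU bV bW i (c p) (d q)))).det
  refine ⟨{p | ∃ c d, p = minor c d}, ?_, ?_⟩
  · rintro _ ⟨c, d, rfl⟩
    refine ⟨_, isWeightedHomogeneous_det (m := fun _ => (0, 1) + (1, 0)) fun p q => ?_⟩
    rw [Matrix.of_apply]
    exact .sum _ _ _ fun i _ =>
      (isWeightedHomogeneous_X _ _ _).mul (isWeightedHomogeneous_X _ _ _)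
  · ext z
    have heval (c d) : eval (Sum.elim (fun φ => φ z.1.rep) fun ψ => ψ z.2.rep) (minor c d) =
        (Matrix.of fun p q =>
          ∑ i, z.2.rep (bU i) * tensorCoord bU bV bW i (c p) (d q) z.1.rep).det := by
      rw [RingHom.map_det]
      refine congrArg Matrix.det (Matrix.ext fun p q => ?_)
      simp
    rw [projIncidence, Set.mem_ofPred_eq, rk_contract_le_iff_forall_minor bU bV bW]
    simp only [← heval]
    exact ⟨by rintro h _ ⟨c, d, rfl⟩; exact h c d, fun h c d => h _ ⟨c, d, rfl⟩⟩

theorem image_fst_projIncidence (r : ℕ) :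
    Prod.fst '' projIncidence F U V W r = projMinrankVariety F U V W r := by
  ext t
  constructor
  · rintro ⟨z, hz, rfl⟩
    exact ⟨z.2.rep, z.2.rep_nonzero, hz⟩
  · rintro ⟨x, hx, hr⟩
    refine ⟨(t, .mk F x hx), ?_, rfl⟩
    obtain ⟨a, ha⟩ := Projectivization.exists_smul_eq_mk_rep F x hx
    rw [projIncidence, Set.mem_ofPred_eq, ← ha, Units.smul_def, map_smul, LinearMap.smul_apply]
    exact (rk_smul_le _ _).trans hr

theorem isProjClosed_projMinrankVariety [IsAlgClosed F] [FiniteDimensional F U] (r : ℕ) :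
    IsProjClosed F (projMinrankVariety F U V W r) := by
  rw [← image_fst_projIncidence]
  exact (isBiprojClosed_projIncidence r).isProjClosed_image_fst

theorem minrankVariety_eq_affineCone [Nontrivial U] (r : ℕ) :
    minrankVariety F U V W r = affineCone F (projMinrankVariety F U V W r) := by
  ext T
  by_cases hT0 : T = 0
  · simp [hT0, zero_mem_minrankVariety, affineCone]
  obtain ⟨a, ha⟩ := Projectivization.exists_smul_eq_mk_rep F T hT0
  have hrep : T ∈ minrankVariety F U V W r ↔
      (Projectivization.mk F T hT0).rep ∈ minrankVariety F U V W r := by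
    rw [← ha]
    refine ⟨fun h => smul_mem_minrankVariety h _, fun h => ?_⟩
    simpa only [← Units.smul_def, inv_smul_smul] using smul_mem_minrankVariety h (a⁻¹ : Fˣ)
  exact hrep.trans ⟨fun h _ => h, fun h => h hT0⟩

theorem isZariskiClosed_minrankVariety [IsAlgClosed F] [FiniteDimensional F U] (r : ℕ) :
    IsZariskiClosed F (minrankVariety F U V W r) := by
  rcases subsingleton_or_nontrivial U with _ | _
  · rw [minrankVariety_eq_empty]
    exact isZariskiClosed_empty
  · rw [minrankVariety_eq_affineCone]
    exact (isProjClosed_projMinrankVariety r).isZariskiClosed_affineCone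

end Variety

section OrbitClosure

variable {F U V W L : Type*} [Field F] [AddCommGroup U] [Module F U] [AddCommGroup V] [Module F V]
  [AddCommGroup W] [Module F W] [AddCommGroup L] [Module F L]

theorem orbit_subset_minrankVariety {r : ℕ} {T : U ⊗[F] (V ⊗[F] W)}
    (hT : T ∈ minrankVariety F U V W r) : orbit F T ⊆ minrankVariety F U V W r := by
  obtain ⟨x, hx, hr⟩ := hT
  rintro _ ⟨⟨g, f, f'⟩, rfl⟩
  refine ⟨x ∘ₗ g.symm.toLinearMap, ?_, ?_⟩
  · exact (LinearEquiv.dualMap g.symm).map_ne_zero_iff.mpr hx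
  · rw [contract_map, LinearMap.comp_assoc, LinearEquiv.symm_comp, LinearMap.comp_id]
    exact (rk_map_le _ _ _).trans hr

theorem contract_coord_blockTensor {k n r : ℕ} (bU : Module.Basis (Fin k) F U)
    (bL : Module.Basis (BlockIndex k n r) F L) (i : Fin k) :
    contract F (bU.coord i) (blockTensor F bU bL) = ∑ j, bL ⟨i, j⟩ ⊗ₜ[F] bL ⟨i, j⟩ := by
  simp [blockTensor, map_sum, Finsupp.single_apply, ite_smul]

theorem blockTensor_mem_minrankVariety {k n r : ℕ} (hk : 1 ≤ k) (bU : Module.Basis (Fin k) F U)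
    (bL : Module.Basis (BlockIndex k n r) F L) :
    blockTensor F bU bL ∈ minrankVariety F U L L r := by
  refine ⟨bU.coord ⟨0, hk⟩, fun h => ?_, ?_⟩
  · simpa using LinearMap.congr_fun h (bU ⟨0, hk⟩)
  · rw [contract_coord_blockTensor]
    exact (rk_sum_tmul_le _ _).trans (by simp)

theorem mem_minrankVariety_of_padding_mem {r : ℕ} {V' W' : Submodule F L}
    {T : U ⊗[F] (V' ⊗[F] W')} (hT : padding F U V' W' T ∈ minrankVariety F U L L r) :
    T ∈ minrankVariety F U V' W' r := by
  obtain ⟨x, hx, hr⟩ := hT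
  refine ⟨x, hx, ?_⟩
  rwa [padding, contract_map, LinearMap.comp_id,
    rk_map_of_injective V'.injective_subtype W'.injective_subtype] at hr

theorem exists_basis_coord_eq {ι : Type*} (b : Module.Basis ι F U) (i : ι) {x : Module.Dual F U}
    (hx : x ≠ 0) : ∃ u : Module.Basis ι F U, u.coord i = x := by
  classical
  obtain ⟨j, hj⟩ : ∃ j, x (b j) ≠ 0 := by
    by_contra! h
    exact hx (b.ext h)
  let c := b.reindex (Equiv.swap i j)
  -- `f u = u + (x u - c.coord i u) • c i` satisfies `c.coord i ∘ f = x`.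
  have hunit : IsUnit (1 + (x - c.coord i) (c i)) := by simpa [c] using hj
  let f := LinearEquiv.dilatransvection hunit
  refine ⟨c.map f.symm, LinearMap.ext fun u => ?_⟩
  have hcoord : (c.map f.symm).coord i u = c.coord i (f u) := rfl
  rw [hcoord, LinearEquiv.dilatransvection.apply]
  simp

theorem map_mem_zariskiClosure_orbit [Infinite F] [FiniteDimensional F V] [FiniteDimensional F W]
    (T : U ⊗[F] (V ⊗[F] W)) (g : U ≃ₗ[F] U) (B : V →ₗ[F] V) (C : W →ₗ[F] W) :
    TensorProduct.map g.toLinearMap (TensorProduct.map B C) T ∈ zariskiClosure F (orbit F T) := by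
  let m (B : Module.End F V) (C : Module.End F W) : U ⊗[F] (V ⊗[F] W) :=
    TensorProduct.map g.toLinearMap (TensorProduct.map B C) T
  -- `B + t • 1` and `C + t • 1` are invertible for all but finitely many `t`.
  let γ (t : F) := m (B + t • 1) (C + t • 1)
  have hγ (t : F) : γ t = t ^ 2 • m 1 1 + t • (m B 1 + m 1 C) + m B C := by
    simp only [γ, m, TensorProduct.map_add_left, TensorProduct.map_add_right,
      TensorProduct.map_smul_left, TensorProduct.map_smul_right, LinearMap.add_apply,
      LinearMap.smul_apply]
    module
  have hpoly (φ : Module.Dual F (U ⊗[F] (V ⊗[F] W))) :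
      ∃ q : Polynomial F, ∀ t, q.eval t = φ (γ t) :=
    ⟨.X ^ 2 * .C (φ (m 1 1)) + .X * .C (φ (m B 1 + m 1 C)) + .C (φ (m B C)), fun t => by
      simp only [hγ, Polynomial.eval_add, Polynomial.eval_mul, Polynomial.eval_pow,
        Polynomial.eval_X, Polynomial.eval_C, map_add, map_smul, smul_eq_mul]⟩
  have horbit : {t | γ t ∈ orbit F T}.Infinite := by
    refine ((Module.End.finite_spectrum (-B)).union
      (Module.End.finite_spectrum (-C))).infinite_compl.mono fun t ht => ?_
    rw [Set.compl_union] at ht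
    have hB : IsUnit (algebraMap F _ t - -B) := not_not.mp ht.1
    have hC : IsUnit (algebraMap F _ t - -C) := not_not.mp ht.2
    rw [sub_neg_eq_add, add_comm, Algebra.algebraMap_eq_smul_one, Module.End.isUnit_iff] at hB hC
    exact ⟨(g, .ofBijective _ hB, .ofBijective _ hC), rfl⟩
  have hγ0 : γ 0 = m B C := by simp [γ]
  have hmem := mem_zariskiClosure_of_infinite γ hpoly horbit 0
  rwa [hγ0] at hmem

theorem exists_map_blockTensor_eq_padding {k n r : ℕ} (hk : 1 ≤ k) (bU : Module.Basis (Fin k) F U)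
    (bL : Module.Basis (BlockIndex k n r) F L) {V' W' : Submodule F L} [FiniteDimensional F V']
    (hV' : Module.finrank F V' ≤ n) {T : U ⊗[F] (V' ⊗[F] W')}
    (hT : T ∈ minrankVariety F U V' W' r) :
    ∃ (g : U ≃ₗ[F] U) (B C : L →ₗ[F] L),
      TensorProduct.map g.toLinearMap (TensorProduct.map B C) (blockTensor F bU bL) =
        padding F U V' W' T := by
  obtain ⟨x, hx, hr⟩ := hT
  obtain ⟨u, rfl⟩ := exists_basis_coord_eq bU ⟨0, hk⟩ hx
  have hrk (i : Fin k) : rk F (contract F (u.coord i) T) ≤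
      Fintype.card (Fin (if (i : ℕ) = 0 then r else n)) := by
    rw [Fintype.card_fin]
    split_ifs with hi
    · rwa [show i = ⟨0, hk⟩ from Fin.ext hi]
    · exact (rk_le_finrank_left _).trans hV'
  choose v w hvw using fun i => exists_eq_sum_tmul_of_rk_le _ (hrk i)
  refine ⟨bU.equiv u (.refl _), bL.constr F fun ij => (v ij.1 ij.2 : L),
    bL.constr F fun ij => (w ij.1 ij.2 : L), ?_⟩
  conv_rhs => rw [← sum_basis_tmul_contract u T]
  rw [blockTensor, map_sum, map_sum]
  refine Finset.sum_congr rfl fun i _ => ?_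
  rw [hvw i]
  simp [padding]

theorem image_padding_minrankVariety [IsAlgClosed F] {k n r : ℕ} (hk : 1 ≤ k)
    (bU : Module.Basis (Fin k) F U) (bL : Module.Basis (BlockIndex k n r) F L)
    (V' W' : Submodule F L) (hV' : Module.finrank F V' ≤ n) :
    padding F U V' W' '' minrankVariety F U V' W' r =
      zariskiClosure F (orbit F (blockTensor F bU bL)) ∩ Set.range (padding F U V' W') := by
  have : FiniteDimensional F U := bU.finiteDimensional_of_finite
  have : FiniteDimensional F L := bL.finiteDimensional_of_finite
  have hclosure : zariskiClosure F (orbit F (blockTensor F bU bL)) ⊆ minrankVariety F U L L r :=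
    zariskiClosure_subset (isZariskiClosed_minrankVariety r)
      (orbit_subset_minrankVariety (blockTensor_mem_minrankVariety hk bU bL))
  apply Set.Subset.antisymm
  · rintro _ ⟨T, hT, rfl⟩
    obtain ⟨g, B, C, hgBC⟩ := exists_map_blockTensor_eq_padding hk bU bL hV' hT
    exact ⟨hgBC ▸ map_mem_zariskiClosure_orbit _ g B C, T, rfl⟩
  · rintro _ ⟨hT, T, rfl⟩
    exact ⟨T, mem_minrankVariety_of_padding_mem (hclosure hT), rfl⟩

end OrbitClosure

end Minrank

end

theorem mainTheorem6_general {F U V W L : Type*} [Field F] [IsAlgClosed F]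
    [AddCommGroup U] [Module F U] [FiniteDimensional F U]
    [AddCommGroup V] [Module F V] [AddCommGroup W] [Module F W]
    [AddCommGroup L] [Module F L] (r : ℕ) :
    ({T : TensorProduct F U (TensorProduct F V W) | Minrank.minrank F T ≤ (r : ℕ∞)} =
        Minrank.minrankVariety F U V W r ∧
      Minrank.IsZariskiClosed F (Minrank.minrankVariety F U V W r)) ∧
    (Minrank.IsBiprojClosed F (Minrank.projIncidence F U V W r) ∧
      Prod.fst '' Minrank.projIncidence F U V W r = Minrank.projMinrankVariety F U V W r ∧
      Minrank.IsProjClosed F (Minrank.projMinrankVariety F U V W r) ∧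
      (Nontrivial U →
        Minrank.minrankVariety F U V W r =
          Minrank.affineCone F (Minrank.projMinrankVariety F U V W r))) ∧
    (∀ (k n : ℕ), 1 ≤ k →
      ∀ (bU : Module.Basis (Fin k) F U) (bL : Module.Basis (Minrank.BlockIndex k n r) F L)
        (V' W' : Submodule F L), Module.finrank F V' ≤ n →
        Minrank.padding F U V' W' '' Minrank.minrankVariety F U V' W' r =
          Minrank.zariskiClosure F (Minrank.orbit F (Minrank.blockTensor F bU bL)) ∩
            Set.range (Minrank.padding F U V' W')) := by
  refine ⟨⟨Minrank.setOf_minrank_le r, Minrank.isZariskiClosed_minrankVariety r⟩,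
    ⟨Minrank.isBiprojClosed_projIncidence r, Minrank.image_fst_projIncidence r,
      Minrank.isProjClosed_projMinrankVariety r, fun _ => Minrank.minrankVariety_eq_affineCone r⟩,
    ?_⟩
  intro k n hk bU bL V' W' hV'
  exact Minrank.image_padding_minrankVariety hk bU bL V' W' hV'

theorem mainTheorem6 {F U V W L : Type*} [Field F] [IsAlgClosed F]
    [AddCommGroup U] [Module F U] [FiniteDimensional F U]
    [AddCommGroup V] [Module F V] [FiniteDimensional F V]
    [AddCommGroup W] [Module F W] [FiniteDimensional F W]
    [AddCommGroup L] [Module F L] [FiniteDimensional F L] (r : ℕ) :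
    -- the tensors of minrank at most `r` form the minrank variety, which is Zariski closed
    ({T : TensorProduct F U (TensorProduct F V W) | Minrank.minrank F T ≤ (r : ℕ∞)} =
        Minrank.minrankVariety F U V W r ∧
      Minrank.IsZariskiClosed F (Minrank.minrankVariety F U V W r)) ∧
    -- it is the cone over the projection of the closed projective incidence variety
    (Minrank.IsBiprojClosed F (Minrank.projIncidence F U V W r) ∧
      Prod.fst '' Minrank.projIncidence F U V W r = Minrank.projMinrankVariety F U V W r ∧
      Minrank.IsProjClosed F (Minrank.projMinrankVariety F U V W r) ∧
      (Nontrivial U →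
        Minrank.minrankVariety F U V W r =
          Minrank.affineCone F (Minrank.projMinrankVariety F U V W r))) ∧
    -- the description as an orbit closure, for subspaces `V'`, `W'` of `L`
    (∀ (k n : ℕ), 1 ≤ k → Module.finrank F U = k → Module.finrank F L = (k - 1) * n + r →
      ∀ (bU : Module.Basis (Fin k) F U) (bL : Module.Basis (Minrank.BlockIndex k n r) F L)
        (V' W' : Submodule F L), Module.finrank F V' = n →
        Minrank.padding F U V' W' '' Minrank.minrankVariety F U V' W' r =
          Minrank.zariskiClosure F (Minrank.orbit F (Minrank.blockTensor F bU bL)) ∩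
            Set.range (Minrank.padding F U V' W')) := by
  obtain ⟨hvariety, hproj, horbit⟩ :=
    mainTheorem6_general (F := F) (U := U) (V := V) (W := W) (L := L) r
  exact ⟨hvariety, hproj, fun k n hk _ _ bU bL V' W' hV' => horbit k n hk bU bL V' W' hV'.le⟩
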